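/- **Theorem (Comparison principle).** Let $n\ge 1$, $0<\lambda\le\Lambda<\infty$, and let $\varphi:(0,\infty)\to(0,\infty)$ be measurable and satisfy, for some constants $a\ge 1$ and $0<\underline\sigma\le\overline\sigma<2$, $$a^{-1}\Big(\frac Rr\Big)^{\underline\sigma}\le\frac{\varphi(R)}{\varphi(r)}\le a\Big(\frac Rr\Big)^{\overline\sigma}\qquad\text{for all }0<r\le R<\infty .$$ Put $C_\varphi=\Big(\int_{\mathbb R^n}\frac{1-\cos y_1}{|y|^n\varphi(|y|)}\,dy\Big)^{-1}$ and let $\mathcal L_0$ be the class of operators $Lu(x)=\int_{\mathbb R^n}\big(u(x+y)+u(x-y)-2u(x)\big)K(y)\,dy$ whose kernels $K$ are measurable, satisfy $K(-y)=K(y)$, $\int_{\mathbb R^n}\frac{|y|^2}{1+|y|^2}K(y)\,dy<\infty$, and $$C_\varphi\frac{\lambda}{|y|^n\varphi(|y|)}\le K(y)\le C_\varphi\frac{\Lambda}{|y|^n\varphi(|y|)}\qquad (y\neq 0).$$ Put $\mathcal M^+u(x)=\sup_{L\in\mathcal L_0}Lu(x)$ and $\mathcal M^-u(x)=\inf_{L\in\mathcal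 L_0}Lu(x)$. A function $\psi$ is $C^{1,1}$ at $x$ if there are $p\in\mathbb R^n$ and $M>0$ with $|\psi(x+y)-\psi(x)-p\cdot y|\le M|y|^2$ for all small $|y|$. Functions on $\mathbb R^n$ are understood to be Lebesgue measurable. Let $I$ be a translation invariant operator that is elliptic with respect to $\mathcal L_0$, that is: (i) $Iu(x)\in\mathbb R$ is defined whenever $u$ is bounded on $\mathbb R^n$ and $C^{1,1}$ at $x$, and then $I(u(\cdot+z))(x-z)=Iu(x)$ for all $z\in\mathbb R^n$; (ii) if $u$ is bounded on $\mathbb R^n$ and $C^2$ in an open set $U$, then $Iu$ is continuous in $U$; (iii) if $u,v$ are bounded on $\mathbb R^n$ and $C^{1,1}$ at $x$, then $$\mathcal M^-(u-v)(x)\le Iu(x)-Iv(x)\le\mathcal M^+(u-v)(x).$$ Let $\Omega\subset\mathbb R^n$ be bounded and open and let $f$ be continuous in $\Omega$. For a bounded function $u:\mathbb R^n\to\mathbb R$, the inequality $Iu\ge f$ (respectively $Iu\le f$) in $\Omega$ in the viscosity sense means that $u$ is upper (respectively lower) semicontinuous in $\overline\Omega$ and that, whenever $x\in\Omega$, $N$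 is an open neighbourhood of $x$ and $\psi$ is a $C^2$ function in $N$ with $\psi(x)=u(x)$ and $\psi>u$ (respectively $\psi<u$) in $N\setminus\{x\}$, the function $w$ equal to $\psi$ in $N$ and to $u$ in $\mathbb R^n\setminus N$ satisfies, provided that it is bounded, $Iw(x)\ge f(x)$ (respectively $Iw(x)\le f(x)$). If $u,v:\mathbb R^n\to\mathbb R$ are bounded functions such that $Iu\ge f$ and $Iv\le f$ in $\Omega$ in the viscosity sense and $u\le v$ in $\mathbb R^n\setminus\Omega$, then $u\le v$ in $\Omega$. -/

import Mathlib

noncomputable section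

namespace IntegroDiff

open MeasureTheory

/-- The space `ℝⁿ` with its Euclidean norm and Lebesgue measure. -/
abbrev Rn (n : ℕ) : Type := EuclideanSpace ℝ (Fin n)

variable {n : ℕ}

/-- `u` is a bounded (Lebesgue measurable) function on `ℝⁿ`. -/
def IsBoundedFun (u : Rn n → ℝ) : Prop :=
  AEMeasurable u volume ∧ ∃ C : ℝ, ∀ x, |u x| ≤ C

/-- The second-order difference `δ(u,x,y) = u(x+y) + u(x-y) - 2u(x)`. -/
def secondDiff (u : Rn n → ℝ) (x y : Rn n) : ℝ :=
  u (x + y) + u (x - y) - 2 * u x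

/-- The linear integro-differential operator `L u(x) = ∫ δ(u,x,y) K(y) dy` with kernel `K`. -/
def linOp (K : Rn n → ℝ) (u : Rn n → ℝ) (x : Rn n) : ℝ :=
  ∫ y, secondDiff u x y * K y

/-- Weak scaling condition with constants `a`, `σ₁`, `σ₂` for a measurable
`φ : (0,∞) → (0,∞)`; the values of `φ` outside `(0,∞)` are irrelevant. -/
structure WeakScaling (φ : ℝ → ℝ) (a σ₁ σ₂ : ℝ) : Prop where
  meas : AEMeasurable φ (volume.restrict (Set.Ioi (0 : ℝ)))
  pos : ∀ r, 0 < r → 0 < φ r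
  one_le_a : 1 ≤ a
  σ₁_pos : 0 < σ₁
  σ₁_le_σ₂ : σ₁ ≤ σ₂
  σ₂_lt_two : σ₂ < 2
  scaling : ∀ r R : ℝ, 0 < r → r ≤ R →
    a⁻¹ * (R / r) ^ σ₁ ≤ φ R / φ r ∧ φ R / φ r ≤ a * (R / r) ^ σ₂

/-- The normalizing constant `C_φ = (∫ (1 - cos y₁) / (|y|ⁿ φ(|y|)) dy)⁻¹`. -/
def normConst (n : ℕ) [NeZero n] (φ : ℝ → ℝ) : ℝ :=
  (∫ y : Rn n, (1 - Real.cos (y 0)) / (‖y‖ ^ n * φ ‖y‖))⁻¹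

/-- The class `𝓛₀`, given through the kernels of its operators: symmetric (measurable) kernels
`K` with `∫ |y|² / (1 + |y|²) K(y) dy < ∞` and
`C_φ λ / (|y|ⁿ φ(|y|)) ≤ K(y) ≤ C_φ Λ / (|y|ⁿ φ(|y|))`. -/
def classL0 (n : ℕ) [NeZero n] (φ : ℝ → ℝ) (lam Lam : ℝ) : Set (Rn n → ℝ) :=
  {K | AEMeasurable K volume ∧ (∀ y, K (-y) = K y) ∧
    Integrable (fun y : Rn n => ‖y‖ ^ 2 / (1 + ‖y‖ ^ 2) * K y) volume ∧
    ∀ y, y ≠ 0 →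
      normConst n φ * (lam / (‖y‖ ^ n * φ ‖y‖)) ≤ K y ∧
      K y ≤ normConst n φ * (Lam / (‖y‖ ^ n * φ ‖y‖))}

/-- The maximal operator `𝓜⁺ u(x) = sup_L L u(x)` of a class of kernels. -/
def maxOp (𝓛 : Set (Rn n → ℝ)) (u : Rn n → ℝ) (x : Rn n) : EReal :=
  ⨆ K ∈ 𝓛, ((linOp K u x : ℝ) : EReal)

/-- The minimal operator `𝓜⁻ u(x) = inf_L L u(x)` of a class of kernels. -/
def minOp (𝓛 : Set (Rn n → ℝ)) (u : Rn n → ℝ) (x : Rn n) : EReal :=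
  ⨅ K ∈ 𝓛, ((linOp K u x : ℝ) : EReal)

/-- `ψ` is `C^{1,1}` at the point `x`. -/
def C11At (ψ : Rn n → ℝ) (x : Rn n) : Prop :=
  ∃ (p : Rn n) (M : ℝ), 0 < M ∧
    ∀ᶠ y in nhds (0 : Rn n), |ψ (x + y) - ψ x - inner ℝ p y| ≤ M * ‖y‖ ^ 2

/-- `I` is elliptic with respect to the class `𝓛`. The value `I u x` is meaningful when `u` is
bounded and `C^{1,1}` at `x`; for other pairs `(u, x)` it is arbitrary and nothing is required. -/
structure IsElliptic (𝓛 : Set (Rn n → ℝ)) (I : (Rn n → ℝ) → Rn n → ℝ) : Prop where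
  continuousOn : ∀ (u : Rn n → ℝ) (U : Set (Rn n)), IsBoundedFun u → IsOpen U →
    ContDiffOn ℝ 2 u U → ContinuousOn (I u) U
  lower : ∀ (u v : Rn n → ℝ) (x : Rn n), IsBoundedFun u → IsBoundedFun v →
    C11At u x → C11At v x → minOp 𝓛 (u - v) x ≤ ((I u x - I v x : ℝ) : EReal)
  upper : ∀ (u v : Rn n → ℝ) (x : Rn n), IsBoundedFun u → IsBoundedFun v →
    C11At u x → C11At v x → ((I u x - I v x : ℝ) : EReal) ≤ maxOp 𝓛 (u - v) x

/-- `I` commutes with translations, wherever its values are meaningful. -/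
def IsTranslationInvariant (I : (Rn n → ℝ) → Rn n → ℝ) : Prop :=
  ∀ (u : Rn n → ℝ) (z x : Rn n), IsBoundedFun u → C11At u (x + z) →
    I (fun y => u (y + z)) x = I u (x + z)

open Classical in
/-- The function equal to `ψ` in `N` and to `u` outside `N`. -/
def glue (N : Set (Rn n)) (ψ u : Rn n → ℝ) : Rn n → ℝ :=
  fun y => if y ∈ N then ψ y else u y

/-- `I u ≥ f` in `Ω` in the viscosity sense. -/
structure IsViscositySub (I : (Rn n → ℝ) → Rn n → ℝ) (Ω : Set (Rn n)) (f u : Rn n → ℝ) :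
    Prop where
  bounded : IsBoundedFun u
  usc : UpperSemicontinuousOn u (closure Ω)
  test : ∀ x ∈ Ω, ∀ (N : Set (Rn n)) (ψ : Rn n → ℝ), IsOpen N → x ∈ N →
    ContDiffOn ℝ 2 ψ N → ψ x = u x → (∀ y ∈ N, y ≠ x → u y < ψ y) →
    IsBoundedFun (glue N ψ u) → f x ≤ I (glue N ψ u) x

/-- `I u ≤ f` in `Ω` in the viscosity sense. -/
structure IsViscositySuper (I : (Rn n → ℝ) → Rn n → ℝ) (Ω : Set (Rn n)) (f u : Rn n → ℝ) :
    Prop where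
  bounded : IsBoundedFun u
  lsc : LowerSemicontinuousOn u (closure Ω)
  test : ∀ x ∈ Ω, ∀ (N : Set (Rn n)) (ψ : Rn n → ℝ), IsOpen N → x ∈ N →
    ContDiffOn ℝ 2 ψ N → ψ x = u x → (∀ y ∈ N, y ≠ x → ψ y < u y) →
    IsBoundedFun (glue N ψ u) → I (glue N ψ u) x ≤ f x

end IntegroDiff

end

/-!
Doubling of variables: if `u - v` is positive somewhere, maximize `u x - v y - c |x - y|²` over
`x, y ∈ Ω`. At a maximum point `(x, y)` a paraboloid touches `u` at `x` from above and another one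
touches `v` at `y` from below, with the same slope. Gluing them in on balls of radius `r` gives test
functions, and translating `x` and `y` to the origin lets ellipticity bound `f x - f y` by the
integral of the Pucci function of the difference of their second-order differences. The curvature
of the paraboloids contributes only for `|z| < r`, hence nothing as `r → 0`, and the remaining
difference is nonpositive as long as `x ± z` and `y ± z` stay in `Ω`.

As `c → ∞` both points tend to one `q ∈ Ω`, and `f x - f y → 0` by continuity. Since `u` and `v` are
merely measurable outside `Ω`, their translates converge only almost everywhere, along a
subsequence. A reverse Fatou argument then suffices: for `|z|` larger than the diameter of `Ω`, the
points `q ± z` lie outside `Ω`, where `u ≤ v`, so the limiting difference is at most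
`-2 max (u - v)`, which makes the limiting integral strictly negative.
-/

noncomputable section

namespace IntegroDiff

open MeasureTheory Filter Topology Set Metric

section Translation

variable {E F : Type*} [NormedAddCommGroup E] [NormedSpace ℝ E] [FiniteDimensional ℝ E]
  [MeasurableSpace E] [BorelSpace E] {μ : Measure E} [μ.IsAddHaarMeasure]
  [NormedAddCommGroup F] {g : E → F} {t : ℕ → E} {s : E}

theorem exists_subseq_tendsto_translate_ae_of_integrable (hg : Integrable g μ)
    (ht : Tendsto t atTop (𝓝 s)) :
    ∃ ns : ℕ → ℕ, StrictMono ns ∧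
      ∀ᵐ z ∂μ, Tendsto (fun k => g (t (ns k) + z)) atTop (𝓝 (g (s + z))) := by
  have : Fact ((1 : ENNReal) ≠ ⊤) := ⟨ENNReal.one_ne_top⟩
  have hgL : MemLp g 1 μ := memLp_one_iff_integrable.2 hg
  have hmk : ∀ c : E, (DomAddAct.mk c +ᵥ hgL.toLp g : Lp F 1 μ) =ᵐ[μ] fun z => g (c + z) :=
    fun c => by
      rw [DomAddAct.mk_vadd_toLp]
      exact MemLp.coeFn_toLp _
  have hLp : Tendsto (fun k => (DomAddAct.mk (t k) +ᵥ hgL.toLp g : Lp F 1 μ)) atTop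
      (𝓝 (DomAddAct.mk s +ᵥ hgL.toLp g)) :=
    (((DomAddAct.continuous_mk).tendsto s).comp ht).vadd_const _
  obtain ⟨ns, hns, hae⟩ := (tendstoInMeasure_of_tendsto_Lp hLp).exists_seq_tendsto_ae
  refine ⟨ns, hns, ?_⟩
  filter_upwards [hae, hmk s, ae_all_iff.2 fun k => hmk (t k)] with z hz hzs hzt
  simpa only [hzs, hzt] using hz

theorem exists_subseq_tendsto_translate_ae [NormedSpace ℝ F] {C : ℝ} (hg : AEStronglyMeasurable g μ)
    (hC : ∀ z, ‖g z‖ ≤ C) (ht : Tendsto t atTop (𝓝 s)) :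
    ∃ ns : ℕ → ℕ, StrictMono ns ∧
      ∀ᵐ z ∂μ, Tendsto (fun k => g (t (ns k) + z)) atTop (𝓝 (g (s + z))) := by
  -- A positive continuous integrable weight `γ` makes `γ g` integrable and can be divided out.
  let γ : E → ℝ := fun z => (1 + ‖z‖) ^ (-(Module.finrank ℝ E + 1 : ℝ))
  have hγ_pos : ∀ z, 0 < γ z := fun z => Real.rpow_pos_of_pos (by positivity) _
  have hγ_cont : Continuous γ :=
    (continuous_const.add continuous_norm).rpow_const fun z =>
      Or.inl (add_pos_of_pos_of_nonneg one_pos (norm_nonneg z)).ne'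
  have hγg : Integrable (fun z => γ z • g z) μ :=
    (integrable_one_add_norm (lt_add_one _)).smul_bdd C hg (Eventually.of_forall hC)
  obtain ⟨ns, hns, hae⟩ := exists_subseq_tendsto_translate_ae_of_integrable hγg ht
  refine ⟨ns, hns, ?_⟩
  filter_upwards [hae] with z hz
  have hγz : Tendsto (fun k => (γ (t (ns k) + z))⁻¹) atTop (𝓝 (γ (s + z))⁻¹) :=
    ((hγ_cont.tendsto _).comp ((ht.comp hns.tendsto_atTop).add_const z)).inv₀ (hγ_pos _).ne'
  simpa only [inv_smul_smul₀ (hγ_pos _).ne'] using hγz.smul hz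

end Translation

section Doubling

variable {X : Type*} [PseudoMetricSpace X] {S : Set X} {u v : X → ℝ}

/-- The penalized difference `u(x) - v(y) - c d(x, y)²` of the doubling of variables. -/
def penalizedDiff (u v : X → ℝ) (c : ℝ) (w : X × X) : ℝ :=
  u w.1 - v w.2 - c * dist w.1 w.2 ^ 2

theorem upperSemicontinuousOn_fst_sub_snd (hu : UpperSemicontinuousOn u S)
    (hv : LowerSemicontinuousOn v S) :
    UpperSemicontinuousOn (fun w : X × X => u w.1 - v w.2) (S ×ˢ S) := by
  simp only [sub_eq_add_neg]
  refine (hu.comp continuous_fst.continuousOn fun w hw => hw.1).add fun w hw b hb => ?_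
  have hv' := hv.comp (t := S ×ˢ S) continuous_snd.continuousOn fun w hw => hw.2
  filter_upwards [hv' w hw (-b) (neg_lt_of_neg_lt hb)] with z hz
  exact neg_lt_of_neg_lt hz

theorem exists_isMaxOn_penalizedDiff (hS : IsCompact S) (hne : S.Nonempty)
    (hu : UpperSemicontinuousOn u S) (hv : LowerSemicontinuousOn v S) (c : ℝ) :
    ∃ w ∈ S ×ˢ S, IsMaxOn (penalizedDiff u v c) (S ×ˢ S) w := by
  refine UpperSemicontinuousOn.exists_isMaxOn (hne.prod hne) (hS.prod hS) ?_
  have hpen : Continuous fun w : X × X => -(c * dist w.1 w.2 ^ 2) := by fun_prop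
  change UpperSemicontinuousOn (fun w : X × X => u w.1 - v w.2 - c * dist w.1 w.2 ^ 2) _
  simpa only [sub_eq_add_neg] using
    (upperSemicontinuousOn_fst_sub_snd hu hv).add hpen.continuousOn.upperSemicontinuousOn

theorem sub_add_penalty_le_of_isMaxOn {c : ℝ} {p : X} {w : X × X} (hp : p ∈ S)
    (hw : IsMaxOn (penalizedDiff u v c) (S ×ˢ S) w) :
    u p - v p + c * dist w.1 w.2 ^ 2 ≤ u w.1 - v w.2 := by
  have h : penalizedDiff u v c (p, p) ≤ penalizedDiff u v c w := hw ⟨hp, hp⟩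
  simp only [penalizedDiff, dist_self] at h
  linarith

theorem sub_le_of_isMaxOn_penalizedDiff {c : ℝ} {p : X} {w : X × X} (hc : 0 ≤ c) (hp : p ∈ S)
    (hw : IsMaxOn (penalizedDiff u v c) (S ×ˢ S) w) : u p - v p ≤ u w.1 - v w.2 := by
  have hpen : 0 ≤ c * dist w.1 w.2 ^ 2 := by positivity
  linarith [sub_add_penalty_le_of_isMaxOn hp hw]

section Limit

variable {c : ℕ → ℝ} {w : ℕ → X × X} {q : X × X} {p : X}

theorem tendsto_dist_of_isMaxOn_penalizedDiff (hu : UpperSemicontinuousOn u S)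
    (hv : LowerSemicontinuousOn v S) (hc : Tendsto c atTop atTop) (hwS : ∀ k, w k ∈ S ×ˢ S)
    (hmax : ∀ k, IsMaxOn (penalizedDiff u v (c k)) (S ×ˢ S) (w k))
    (hq : q ∈ S ×ˢ S) (hw : Tendsto w atTop (𝓝 q)) (hp : p ∈ S) :
    Tendsto (fun k => dist (w k).1 (w k).2 ^ 2) atTop (𝓝 0) := by
  have hwS' : Tendsto w atTop (𝓝[S ×ˢ S] q) :=
    tendsto_nhdsWithin_iff.2 ⟨hw, Eventually.of_forall hwS⟩
  have hbdd := hwS'.eventually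
    (upperSemicontinuousOn_fst_sub_snd hu hv q hq (u q.1 - v q.2 + 1) (lt_add_one _))
  refine squeeze_zero' (Eventually.of_forall fun k => sq_nonneg _) ?_
    (hc.const_div_atTop (u q.1 - v q.2 + 1 - (u p - v p)))
  filter_upwards [hbdd, hc.eventually_gt_atTop 0] with k hk hck
  rw [le_div_iff₀' hck]
  linarith [sub_add_penalty_le_of_isMaxOn hp (hmax k)]

theorem sub_le_of_tendsto_of_isMaxOn_penalizedDiff (hu : UpperSemicontinuousOn u S)
    (hv : LowerSemicontinuousOn v S) (hc : ∀ k, 0 ≤ c k) (hwS : ∀ k, w k ∈ S ×ˢ S)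
    (hmax : ∀ k, IsMaxOn (penalizedDiff u v (c k)) (S ×ˢ S) (w k))
    (hq : q ∈ S ×ˢ S) (hw : Tendsto w atTop (𝓝 q)) (hp : p ∈ S) :
    u p - v p ≤ u q.1 - v q.2 := by
  have hwS' : Tendsto w atTop (𝓝[S ×ˢ S] q) :=
    tendsto_nhdsWithin_iff.2 ⟨hw, Eventually.of_forall hwS⟩
  refine le_of_forall_gt fun b hb => ?_
  obtain ⟨k, hk⟩ := (hwS'.eventually (upperSemicontinuousOn_fst_sub_snd hu hv q hq b hb)).exists
  exact (sub_le_of_isMaxOn_penalizedDiff (hc k) hp (hmax k)).trans_lt hk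

end Limit

theorem exists_tendsto_isMaxOn_penalizedDiff {X : Type*} [MetricSpace X] {S : Set X} {u v : X → ℝ}
    (hS : IsCompact S) (hu : UpperSemicontinuousOn u S) (hv : LowerSemicontinuousOn v S) {p : X}
    (hp : p ∈ S) :
    ∃ (c : ℕ → ℝ) (x y : ℕ → X) (q : X), (∀ k, 0 ≤ c k) ∧
      (∀ k, IsMaxOn (penalizedDiff u v (c k)) (S ×ˢ S) (x k, y k)) ∧
      Tendsto x atTop (𝓝 q) ∧ Tendsto y atTop (𝓝 q) ∧ u p - v p ≤ u q - v q := by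
  choose w hwS hmax using fun k : ℕ => exists_isMaxOn_penalizedDiff hS ⟨p, hp⟩ hu hv (k : ℝ)
  obtain ⟨⟨q, q'⟩, hq, ns, hns, hlim⟩ := (hS.prod hS).tendsto_subseq hwS
  have hc : Tendsto (fun k => (ns k : ℝ)) atTop atTop :=
    tendsto_natCast_atTop_atTop.comp hns.tendsto_atTop
  obtain ⟨hx, hy⟩ := Prod.tendsto_iff _ _ |>.1 hlim
  have hdist : dist q q' ^ 2 = 0 := tendsto_nhds_unique ((hx.dist hy).pow 2)
    (tendsto_dist_of_isMaxOn_penalizedDiff hu hv hc (fun k => hwS _) (fun k => hmax _) hq hlim hp)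
  obtain rfl : q = q' := by simpa using hdist
  exact ⟨fun k => ns k, _, _, q, fun k => Nat.cast_nonneg _, fun k => hmax _, hx, hy,
    sub_le_of_tendsto_of_isMaxOn_penalizedDiff hu hv (fun k => Nat.cast_nonneg _) (fun k => hwS _)
      (fun k => hmax _) hq hlim hp⟩

end Doubling

section LevyKernel

variable {n : ℕ} {z : Rn n} {k kmin kmax d e : Rn n → ℝ} {B : ℝ}

/-- The Lévy weight `|y|² / (1 + |y|²)`, comparable to `min 1 |y|²`. -/
def levyWeight (y : Rn n) : ℝ :=
  ‖y‖ ^ 2 / (1 + ‖y‖ ^ 2)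

@[fun_prop]
theorem measurable_levyWeight : Measurable (levyWeight : Rn n → ℝ) := by
  unfold levyWeight
  fun_prop

theorem levyWeight_nonneg (y : Rn n) : 0 ≤ levyWeight y := by
  unfold levyWeight
  positivity

theorem le_mul_levyWeight {t A C ρ : ℝ} (hρ : 0 < ρ) (hA : 0 ≤ A) (hC : 0 ≤ C)
    (hnear : ‖z‖ < ρ → t ≤ A * ‖z‖ ^ 2) (hfar : ρ ≤ ‖z‖ → t ≤ C) :
    t ≤ (A + C / ρ ^ 2) * (1 + ρ ^ 2) * levyWeight z := by
  rw [levyWeight, ← mul_div_assoc, le_div_iff₀ (by positivity)]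
  rcases lt_or_ge ‖z‖ ρ with h | h
  · calc t * (1 + ‖z‖ ^ 2) ≤ A * ‖z‖ ^ 2 * (1 + ρ ^ 2) := by
          gcongr
          exact hnear h
      _ = A * (1 + ρ ^ 2) * ‖z‖ ^ 2 := by ring
      _ ≤ (A + C / ρ ^ 2) * (1 + ρ ^ 2) * ‖z‖ ^ 2 := by
          gcongr
          exact le_add_of_nonneg_right (by positivity)
  · have hρz : ρ ^ 2 * (1 + ‖z‖ ^ 2) ≤ (1 + ρ ^ 2) * ‖z‖ ^ 2 := by
      have : ρ ^ 2 ≤ ‖z‖ ^ 2 := by gcongr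
      linarith
    calc t * (1 + ‖z‖ ^ 2) ≤ C * (1 + ‖z‖ ^ 2) := by
          gcongr
          exact hfar h
      _ = C / ρ ^ 2 * (ρ ^ 2 * (1 + ‖z‖ ^ 2)) := by field_simp
      _ ≤ C / ρ ^ 2 * ((1 + ρ ^ 2) * ‖z‖ ^ 2) := by gcongr
      _ = C / ρ ^ 2 * (1 + ρ ^ 2) * ‖z‖ ^ 2 := by ring
      _ ≤ (A + C / ρ ^ 2) * (1 + ρ ^ 2) * ‖z‖ ^ 2 := by
          gcongr
          exact le_add_of_nonneg_left hA

theorem abs_indicator_le_mul_levyWeight {g : Rn n → ℝ} {S : Set (Rn n)} {C ρ : ℝ} (hC : 0 ≤ C)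
    (hρ : 0 < ρ) (hS : S ⊆ (ball 0 ρ)ᶜ) (hg : ∀ z, |g z| ≤ C) (z : Rn n) :
    |S.indicator g z| ≤ C / ρ ^ 2 * (1 + ρ ^ 2) * levyWeight z := by
  have hC_ind : |S.indicator g z| ≤ C := (norm_indicator_le_norm_self g z).trans (hg z)
  simpa only [zero_add] using le_mul_levyWeight hρ le_rfl hC
    (fun hz => by simp [indicator_of_notMem fun h => hS h (mem_ball_zero_iff.2 hz)])
    fun _ => hC_ind

/-- A Lévy kernel: a nonnegative kernel that integrates the Lévy weight. -/
structure IsLevyKernel (k : Rn n → ℝ) : Prop where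
  nonneg : 0 ≤ᵐ[volume] k
  integrable : Integrable (fun y => levyWeight y * k y)

theorem IsLevyKernel.integrable_mul (hk : IsLevyKernel k) (hd : AEMeasurable d)
    (hB : ∀ z, |d z| ≤ B * levyWeight z) : Integrable (fun z => d z * k z) := by
  have hquot : Integrable (fun z => d z / levyWeight z * (levyWeight z * k z)) := by
    refine hk.integrable.bdd_mul (c := |B|)
      (hd.div measurable_levyWeight.aemeasurable).aestronglyMeasurable (ae_of_all _ fun z => ?_)
    rw [Real.norm_eq_abs, abs_div, abs_of_nonneg (levyWeight_nonneg z)]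
    exact div_le_of_le_mul₀ (levyWeight_nonneg z) (abs_nonneg B)
      ((hB z).trans (mul_le_mul_of_nonneg_right (le_abs_self B) (levyWeight_nonneg z)))
  refine hquot.congr (ae_of_all _ fun z => ?_)
  have hd0 : levyWeight z = 0 → d z = 0 := fun h => by simpa [h] using hB z
  simp only [← mul_assoc, div_mul_cancel_of_imp hd0]

theorem IsLevyKernel.const_mul (hk : IsLevyKernel k) {t : ℝ} (ht : 0 ≤ t) :
    IsLevyKernel fun y => t * k y := by
  refine ⟨hk.nonneg.mono fun y hy => mul_nonneg ht hy, ?_⟩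
  simpa only [mul_left_comm] using hk.integrable.const_mul t

theorem IsLevyKernel.integrableOn_compl_ball (hk : IsLevyKernel k) {D : ℝ} (hD : 0 < D) :
    IntegrableOn k (ball 0 D)ᶜ := by
  rw [← integrable_indicator_iff measurableSet_ball.compl]
  have hmul := hk.integrable_mul (d := (ball 0 D)ᶜ.indicator 1)
    (aemeasurable_const.indicator measurableSet_ball.compl)
    (abs_indicator_le_mul_levyWeight zero_le_one hD le_rfl fun z => by simp)
  simpa only [← indicator_mul_left, Pi.one_apply, one_mul] using hmul

theorem IsLevyKernel.setIntegral_compl_ball_pos [NeZero n] (hk : IsLevyKernel k)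
    (hpos : ∀ y ≠ 0, 0 < k y) {D : ℝ} (hD : 0 < D) : 0 < ∫ y in (ball 0 D)ᶜ, k y := by
  rw [setIntegral_pos_iff_support_of_nonneg_ae (ae_restrict_of_ae hk.nonneg)
    (hk.integrableOn_compl_ball hD)]
  have hne : ((closedBall (0 : Rn n) D)ᶜ).Nonempty := by
    obtain ⟨y, hy⟩ := NormedSpace.exists_lt_norm ℝ (Rn n) D
    exact ⟨y, by simpa using hy⟩
  refine (isClosed_closedBall.isOpen_compl.measure_pos volume hne).trans_le
    (measure_mono fun y hy => ?_)
  have hy' : D < ‖y‖ := by simpa using hy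
  exact ⟨(hpos y (norm_pos_iff.1 (hD.trans hy'))).ne', by simpa using hy'.le⟩

/-- The kernels lying between `kmin` and `kmax`. -/
def kernelsBetween (kmin kmax : Rn n → ℝ) : Set (Rn n → ℝ) :=
  {K | IsLevyKernel K ∧ kmin ≤ᵐ[volume] K ∧ K ≤ᵐ[volume] kmax}

/-- The integrand of the extremal operator `𝓜⁺` of the kernels between `kmin` and `kmax`, as a
function of the second-order difference `d`: the largest kernel is charged to the positive part of
`d` and the smallest one to its negative part. -/
def pucci (kmin kmax d : Rn n → ℝ) (z : Rn n) : ℝ :=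
  kmax z * (d z)⁺ - kmin z * (d z)⁻

theorem mul_le_pucci (hmin : kmin z ≤ k z) (hmax : k z ≤ kmax z) :
    d z * k z ≤ pucci kmin kmax d z := by
  calc d z * k z = k z * (d z)⁺ - k z * (d z)⁻ := by
        rw [← mul_sub, posPart_sub_negPart, mul_comm]
    _ ≤ pucci kmin kmax d z :=
        sub_le_sub (mul_le_mul_of_nonneg_right hmax (posPart_nonneg _))
          (mul_le_mul_of_nonneg_right hmin (negPart_nonneg _))

theorem pucci_mono (hmin : 0 ≤ kmin z) (hmax : 0 ≤ kmax z) (h : d z ≤ e z) :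
    pucci kmin kmax d z ≤ pucci kmin kmax e z :=
  sub_le_sub (mul_le_mul_of_nonneg_left (posPart_mono h) hmax)
    (mul_le_mul_of_nonneg_left (negPart_anti h) hmin)

theorem abs_posPart_le (t : ℝ) : |t⁺| ≤ |t| := by
  rw [abs_of_nonneg (posPart_nonneg t), ← posPart_add_negPart t]
  exact le_add_of_nonneg_right (negPart_nonneg t)

theorem abs_negPart_le (t : ℝ) : |t⁻| ≤ |t| := by
  rw [← posPart_neg, ← abs_neg t]
  exact abs_posPart_le (-t)

theorem abs_pucci_le (hmin : 0 ≤ kmin z) (hmax : 0 ≤ kmax z) :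
    |pucci kmin kmax d z| ≤ |d z| * kmax z + |d z| * kmin z := by
  refine (abs_sub _ _).trans ?_
  rw [abs_mul, abs_mul, abs_of_nonneg hmin, abs_of_nonneg hmax, mul_comm, mul_comm (kmin z)]
  exact add_le_add (mul_le_mul_of_nonneg_right (abs_posPart_le _) hmax)
    (mul_le_mul_of_nonneg_right (abs_negPart_le _) hmin)

section Integral

variable (hmin : IsLevyKernel kmin) (hmax : IsLevyKernel kmax)

include hmin hmax

theorem integrable_pucci (hd : AEMeasurable d) (hB : ∀ z, |d z| ≤ B * levyWeight z) :
    Integrable (pucci kmin kmax d) := by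
  refine Integrable.sub ?_ ?_
  · simp only [mul_comm (kmax _)]
    exact hmax.integrable_mul (continuous_posPart.measurable.comp_aemeasurable hd)
      fun z => (abs_posPart_le _).trans (hB z)
  · simp only [mul_comm (kmin _)]
    exact hmin.integrable_mul (continuous_negPart.measurable.comp_aemeasurable hd)
      fun z => (abs_negPart_le _).trans (hB z)

theorem integral_pucci_mono {B' : ℝ} (hd : AEMeasurable d) (hdB : ∀ z, |d z| ≤ B * levyWeight z)
    (he : AEMeasurable e) (heB : ∀ z, |e z| ≤ B' * levyWeight z) (h : ∀ᵐ z, d z ≤ e z) :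
    ∫ z, pucci kmin kmax d z ≤ ∫ z, pucci kmin kmax e z := by
  refine integral_mono_ae (integrable_pucci hmin hmax hd hdB) (integrable_pucci hmin hmax he heB) ?_
  filter_upwards [hmin.nonneg, hmax.nonneg, h] with z h₁ h₂ hz using pucci_mono h₁ h₂ hz

theorem tendsto_integral_pucci {d : ℕ → Rn n → ℝ} (hd : ∀ j, AEMeasurable (d j))
    (hdB : ∀ j z, |d j z| ≤ B * levyWeight z)
    (h : ∀ᵐ z, Tendsto (fun j => d j z) atTop (𝓝 (e z))) :
    Tendsto (fun j => ∫ z, pucci kmin kmax (d j) z) atTop (𝓝 (∫ z, pucci kmin kmax e z)) := by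
  refine tendsto_integral_of_dominated_convergence
    (fun z => B * (levyWeight z * kmax z) + B * (levyWeight z * kmin z))
    (fun j => (integrable_pucci hmin hmax (hd j) (hdB j)).aestronglyMeasurable)
    ((hmax.integrable.const_mul B).add (hmin.integrable.const_mul B)) (fun j => ?_) ?_
  · filter_upwards [hmin.nonneg, hmax.nonneg] with z h₁ h₂
    simp only [← mul_assoc]
    exact (abs_pucci_le h₁ h₂).trans (add_le_add (mul_le_mul_of_nonneg_right (hdB j z) h₂)
      (mul_le_mul_of_nonneg_right (hdB j z) h₁))
  · filter_upwards [h] with z hz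
    exact (((continuous_posPart.tendsto _).comp hz).const_mul _).sub
      (((continuous_negPart.tendsto _).comp hz).const_mul _)

theorem le_integral_pucci_of_eventually_le {d : ℕ → Rn n → ℝ} {A : ℕ → ℝ} {a : ℝ}
    (hd : ∀ j, AEMeasurable (d j)) (hdB : ∀ j z, |d j z| ≤ B * levyWeight z)
    (he : AEMeasurable e) (heB : ∀ z, |e z| ≤ B * levyWeight z)
    (hle : ∀ᵐ z, ∀ ε > 0, ∀ᶠ j in atTop, d j z ≤ e z + ε)
    (hA : ∀ᶠ j in atTop, A j ≤ ∫ z, pucci kmin kmax (d j) z) (ha : Tendsto A atTop (𝓝 a)) :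
    a ≤ ∫ z, pucci kmin kmax e z := by
  -- Reverse Fatou: replacing `d j` by `max (d j) e` only increases the integral and turns the
  -- asymptotic upper bound into convergence.
  have hmB : ∀ j z, |max (d j z) (e z)| ≤ B * levyWeight z := fun j z =>
    abs_max_le_max_abs_abs.trans (max_le (hdB j z) (heB z))
  have hm : ∀ j, AEMeasurable fun z => max (d j z) (e z) := fun j => (hd j).max he
  refine le_of_tendsto_of_tendsto ha (tendsto_integral_pucci hmin hmax hm hmB ?_)
    (hA.mono fun j hj => hj.trans (integral_pucci_mono hmin hmax (hd j) (hdB j) (hm j) (hmB j)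
      (ae_of_all _ fun z => le_max_left _ _)))
  filter_upwards [hle] with z hz
  refine tendsto_order.2 ⟨fun b hb => Eventually.of_forall fun j => lt_max_of_lt_right hb,
    fun b hb => ?_⟩
  filter_upwards [hz ((b - e z) / 2) (by linarith)] with j hj
  exact max_lt (by linarith) hb

theorem maxOp_kernelsBetween_le {u : Rn n → ℝ} {x : Rn n} (hd : AEMeasurable (secondDiff u x))
    (hB : ∀ z, |secondDiff u x z| ≤ B * levyWeight z) :
    maxOp (kernelsBetween kmin kmax) u x ≤
      ((∫ z, pucci kmin kmax (secondDiff u x) z : ℝ) : EReal) := by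
  refine iSup₂_le fun K hK => EReal.coe_le_coe_iff.2 ?_
  refine integral_mono_ae (hK.1.integrable_mul hd hB) (integrable_pucci hmin hmax hd hB) ?_
  filter_upwards [hK.2.1, hK.2.2] with z h₁ h₂ using mul_le_pucci h₁ h₂

end Integral

end LevyKernel

section SecondDiff

variable {n : ℕ} {u v : Rn n → ℝ} {x y z : Rn n}

theorem aemeasurable_secondDiff (hu : AEMeasurable u) (x : Rn n) :
    AEMeasurable (secondDiff u x) :=
  ((hu.comp_quasiMeasurePreserving
    (measurePreserving_add_left volume x).quasiMeasurePreserving).add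
    (hu.comp_quasiMeasurePreserving
      (Measure.measurePreserving_sub_left volume x).quasiMeasurePreserving)).sub_const _

theorem abs_secondDiff_le {C : ℝ} (hC : ∀ x, |u x| ≤ C) (x z : Rn n) :
    |secondDiff u x z| ≤ 4 * C := by
  have h₁ := abs_le.1 (hC (x + z))
  have h₂ := abs_le.1 (hC (x - z))
  have h₃ := abs_le.1 (hC x)
  rw [secondDiff, abs_le]
  constructor <;> linarith

theorem C11At.exists_abs_secondDiff_le_sq (hu : C11At u x) :
    ∃ A ≥ 0, ∃ ρ > 0, ∀ z, ‖z‖ < ρ → |secondDiff u x z| ≤ A * ‖z‖ ^ 2 := by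
  obtain ⟨p, M, hM, h⟩ := hu
  obtain ⟨ρ, hρ, hball⟩ := Metric.eventually_nhds_iff_ball.1 h
  refine ⟨2 * M, by positivity, ρ, hρ, fun z hz => ?_⟩
  have hpos := abs_le.1 (hball z (mem_ball_zero_iff.2 hz))
  have hneg := abs_le.1 (hball (-z) (mem_ball_zero_iff.2 (by rwa [norm_neg])))
  rw [inner_neg_right, norm_neg, ← sub_eq_add_neg] at hneg
  rw [secondDiff, abs_le]
  constructor <;> linarith

theorem C11At.exists_abs_secondDiff_le (hx : C11At u x) (hu : IsBoundedFun u) :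
    ∃ B, ∀ z, |secondDiff u x z| ≤ B * levyWeight z := by
  obtain ⟨C, hC⟩ := hu.2
  obtain ⟨A, hA, ρ, hρ, hnear⟩ := hx.exists_abs_secondDiff_le_sq
  have hC₀ : 0 ≤ 4 * C := by linarith [(abs_nonneg _).trans (hC 0)]
  exact ⟨_, fun z => le_mul_levyWeight hρ hA hC₀ (hnear z) fun _ => abs_secondDiff_le hC x z⟩

theorem IsBoundedFun.sub (hu : IsBoundedFun u) (hv : IsBoundedFun v) : IsBoundedFun (u - v) := by
  obtain ⟨hum, C, hC⟩ := hu
  obtain ⟨hvm, C', hC'⟩ := hv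
  exact ⟨hum.sub hvm, C + C', fun z => (abs_sub _ _).trans (add_le_add (hC z) (hC' z))⟩

theorem IsBoundedFun.translate (hu : IsBoundedFun u) (x : Rn n) :
    IsBoundedFun fun z => u (z + x) := by
  obtain ⟨hm, C, hC⟩ := hu
  exact ⟨hm.comp_quasiMeasurePreserving
    (measurePreserving_add_right volume x).quasiMeasurePreserving, C, fun z => hC _⟩

theorem C11At.translate (hu : C11At u x) : C11At (fun z => u (z + x)) 0 := by
  simpa only [C11At, zero_add, add_zero, add_comm _ x] using hu

theorem IsTranslationInvariant.apply_translate_zero {I : (Rn n → ℝ) → Rn n → ℝ}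
    (hI : IsTranslationInvariant I) (hu : IsBoundedFun u) (hx : C11At u x) :
    I (fun z => u (z + x)) 0 = I u x := by
  simpa only [zero_add] using hI u x 0 hu (by rwa [zero_add])

/-- The difference `δ(u, x, z) - δ(v, y, z)` of the second-order differences of `u` and `v` at the
two points of a doubling of variables. -/
def doubledDiff (u v : Rn n → ℝ) (x y z : Rn n) : ℝ :=
  secondDiff u x z - secondDiff v y z

theorem aemeasurable_doubledDiff (hu : AEMeasurable u) (hv : AEMeasurable v) (x y : Rn n) :
    AEMeasurable (doubledDiff u v x y) :=
  (aemeasurable_secondDiff hu x).sub (aemeasurable_secondDiff hv y)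

theorem exists_abs_doubledDiff_le (hu : IsBoundedFun u) (hv : IsBoundedFun v) :
    ∃ C ≥ 0, ∀ x y z, |doubledDiff u v x y z| ≤ C := by
  obtain ⟨C, hC⟩ := hu.2
  obtain ⟨C', hC'⟩ := hv.2
  have hC₀ := (abs_nonneg _).trans (hC 0)
  have hC₀' := (abs_nonneg _).trans (hC' 0)
  exact ⟨4 * C + 4 * C', by positivity, fun x y z => (abs_sub _ _).trans
    (add_le_add (abs_secondDiff_le hC x z) (abs_secondDiff_le hC' y z))⟩

theorem exists_abs_doubledDiff_le_mul_levyWeight (hu : IsBoundedFun u) (hv : IsBoundedFun v)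
    (hx : C11At u x) (hy : C11At v y) : ∃ B, ∀ z, |doubledDiff u v x y z| ≤ B * levyWeight z := by
  obtain ⟨B, hB⟩ := hx.exists_abs_secondDiff_le hu
  obtain ⟨B', hB'⟩ := hy.exists_abs_secondDiff_le hv
  refine ⟨B + B', fun z => (abs_sub _ _).trans ?_⟩
  rw [add_mul]
  exact add_le_add (hB z) (hB' z)

/-- The upper half `I u - I v ≤ 𝓜⁺(u - v)` of the ellipticity of `I` with respect to the class
`𝓛`, used to compare the values of `I` at two test functions. -/
def IsUpperElliptic (𝓛 : Set (Rn n → ℝ)) (I : (Rn n → ℝ) → Rn n → ℝ) : Prop :=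
  ∀ (u v : Rn n → ℝ) (x : Rn n), IsBoundedFun u → IsBoundedFun v → C11At u x → C11At v x →
    ((I u x - I v x : ℝ) : EReal) ≤ maxOp 𝓛 (u - v) x

theorem IsElliptic.isUpperElliptic {𝓛 : Set (Rn n → ℝ)} {I : (Rn n → ℝ) → Rn n → ℝ}
    (hI : IsElliptic 𝓛 I) : IsUpperElliptic 𝓛 I :=
  hI.upper

theorem IsUpperElliptic.mono {𝓛 𝓛' : Set (Rn n → ℝ)} {I : (Rn n → ℝ) → Rn n → ℝ}
    (hI : IsUpperElliptic 𝓛 I) (h : 𝓛 ⊆ 𝓛') : IsUpperElliptic 𝓛' I :=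
  fun u v x hu hv hux hvx => (hI u v x hu hv hux hvx).trans (biSup_mono fun _ hK => h hK)

theorem IsUpperElliptic.sub_le_integral_pucci {kmin kmax : Rn n → ℝ}
    {I : (Rn n → ℝ) → Rn n → ℝ} (hI : IsUpperElliptic (kernelsBetween kmin kmax) I)
    (hIt : IsTranslationInvariant I) (hmin : IsLevyKernel kmin) (hmax : IsLevyKernel kmax)
    (hu : IsBoundedFun u) (hv : IsBoundedFun v) (hx : C11At u x) (hy : C11At v y) :
    I u x - I v y ≤ ∫ z, pucci kmin kmax (doubledDiff u v x y) z := by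
  -- Translating `x` and `y` to the origin makes ellipticity applicable at two different points.
  let D : Rn n → ℝ := (fun z => u (z + x)) - fun z => v (z + y)
  have hD : secondDiff D 0 = doubledDiff u v x y := by
    funext z
    simp only [D, doubledDiff, secondDiff, Pi.sub_apply, zero_add, zero_sub, add_comm z,
      neg_add_eq_sub]
    ring
  have hell := hI _ _ 0 (hu.translate x) (hv.translate y) hx.translate hy.translate
  rw [hIt.apply_translate_zero hu hx, hIt.apply_translate_zero hv hy] at hell
  obtain ⟨B, hB⟩ := exists_abs_doubledDiff_le_mul_levyWeight hu hv hx hy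
  have hmaxOp := maxOp_kernelsBetween_le hmin hmax (B := B) (u := D) (x := 0)
    (aemeasurable_secondDiff ((hu.translate x).sub (hv.translate y)).1 0) (by rwa [hD])
  rw [hD] at hmaxOp
  exact EReal.coe_le_coe_iff.1 (hell.trans hmaxOp)

end SecondDiff

section Paraboloid

variable {n : ℕ} {u : Rn n → ℝ} {p x z : Rn n} {b r : ℝ}

/-- The function `α + p · (z - x) + b |z - x|²` of `z`. -/
def paraboloid (x : Rn n) (α : ℝ) (p : Rn n) (b : ℝ) (z : Rn n) : ℝ :=
  α + inner ℝ p (z - x) + b * ‖z - x‖ ^ 2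

/-- The function `u` with its values on the ball `B_r(x)` replaced by those of the paraboloid with
vertex value `u x`, slope `p` and curvature `b` at `x`. -/
def paraboloidGlue (u : Rn n → ℝ) (x : Rn n) (r : ℝ) (p : Rn n) (b : ℝ) : Rn n → ℝ :=
  glue (ball x r) (paraboloid x (u x) p b) u

theorem contDiff_paraboloid (x : Rn n) (α : ℝ) (p : Rn n) (b : ℝ) :
    ContDiff ℝ 2 (paraboloid x α p b) := by
  have hsub : ContDiff ℝ 2 fun z : Rn n => z - x := contDiff_id.sub contDiff_const
  exact (contDiff_const.add (contDiff_const.inner ℝ hsub)).add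
    (contDiff_const.mul (hsub.norm_sq ℝ))

theorem paraboloid_self (x : Rn n) (α : ℝ) (p : Rn n) (b : ℝ) : paraboloid x α p b x = α := by
  simp [paraboloid]

theorem paraboloid_add (x : Rn n) (α : ℝ) (p : Rn n) (b : ℝ) (z : Rn n) :
    paraboloid x α p b (x + z) = α + inner ℝ p z + b * ‖z‖ ^ 2 := by
  rw [paraboloid, add_sub_cancel_left]

theorem paraboloid_lt_paraboloid {b' α : ℝ} (hb : b < b') (hz : z ≠ x) :
    paraboloid x α p b z < paraboloid x α p b' z := by
  have : 0 < ‖z - x‖ := norm_sub_pos_iff.2 hz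
  unfold paraboloid
  gcongr

theorem IsBoundedFun.glue_ball {ψ : Rn n → ℝ} (hu : IsBoundedFun u) (hψ : Continuous ψ)
    (x : Rn n) (r : ℝ) : IsBoundedFun (glue (ball x r) ψ u) := by
  obtain ⟨hm, C, hC⟩ := hu
  have hglue : glue (ball x r) ψ u = (ball x r).indicator ψ + (ball x r)ᶜ.indicator u := by
    funext z
    by_cases hz : z ∈ ball x r <;> simp [glue, hz, -mem_ball]
  obtain ⟨C', hC'⟩ := (isCompact_closedBall x r).exists_bound_of_continuousOn hψ.continuousOn
  refine ⟨hglue ▸ (hψ.measurable.indicator measurableSet_ball).aemeasurable.add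
    (hm.indicator measurableSet_ball.compl), max C C', fun z => ?_⟩
  by_cases hz : z ∈ ball x r <;> simp only [glue, hz, if_true, if_false]
  · exact le_max_of_le_right (hC' z (ball_subset_closedBall hz))
  · exact le_max_of_le_left (hC z)

theorem IsBoundedFun.paraboloidGlue (hu : IsBoundedFun u) (x : Rn n) (r : ℝ) (p : Rn n) (b : ℝ) :
    IsBoundedFun (paraboloidGlue u x r p b) :=
  hu.glue_ball (contDiff_paraboloid _ _ _ _).continuous x r

theorem paraboloidGlue_self : paraboloidGlue u x r p b x = u x := by
  rw [paraboloidGlue, glue, paraboloid_self, ite_self]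

theorem paraboloidGlue_add_of_lt (hz : ‖z‖ < r) :
    paraboloidGlue u x r p b (x + z) = u x + inner ℝ p z + b * ‖z‖ ^ 2 := by
  simp [paraboloidGlue, glue, paraboloid_add, hz]

theorem paraboloidGlue_add_of_le (hz : r ≤ ‖z‖) : paraboloidGlue u x r p b (x + z) = u (x + z) := by
  simp [paraboloidGlue, glue, hz.not_gt]

theorem c11At_paraboloidGlue (hr : 0 < r) : C11At (paraboloidGlue u x r p b) x := by
  refine ⟨p, |b| + 1, by positivity, ?_⟩
  filter_upwards [ball_mem_nhds (0 : Rn n) hr] with z hz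
  rw [paraboloidGlue_add_of_lt (mem_ball_zero_iff.1 hz), paraboloidGlue_self, add_sub_right_comm,
    add_sub_cancel_left, add_sub_cancel_left, abs_mul, abs_of_nonneg (sq_nonneg ‖z‖)]
  gcongr
  exact le_add_of_nonneg_right zero_le_one

theorem secondDiff_paraboloidGlue_of_lt (hz : ‖z‖ < r) :
    secondDiff (paraboloidGlue u x r p b) x z = 2 * b * ‖z‖ ^ 2 := by
  have hneg : ‖-z‖ < r := by rwa [norm_neg]
  rw [secondDiff, sub_eq_add_neg x z, paraboloidGlue_add_of_lt hz, paraboloidGlue_add_of_lt hneg,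
    paraboloidGlue_self, inner_neg_right, norm_neg]
  ring

theorem secondDiff_paraboloidGlue_of_le (hz : r ≤ ‖z‖) :
    secondDiff (paraboloidGlue u x r p b) x z = secondDiff u x z := by
  have hneg : r ≤ ‖-z‖ := by rwa [norm_neg]
  simp only [secondDiff, sub_eq_add_neg x z, paraboloidGlue_add_of_le hz,
    paraboloidGlue_add_of_le hneg, paraboloidGlue_self]

variable {I : (Rn n → ℝ) → Rn n → ℝ} {Ω : Set (Rn n)} {f v : Rn n → ℝ} {b' : ℝ}

theorem IsViscositySub.le_apply_paraboloidGlue (hu : IsViscositySub I Ω f u) (hx : x ∈ Ω)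
    (hr : 0 < r) (hb : b < b') (h : ∀ z ∈ ball x r, u z ≤ paraboloid x (u x) p b z) :
    f x ≤ I (paraboloidGlue u x r p b') x :=
  hu.test x hx _ _ isOpen_ball (mem_ball_self hr) (contDiff_paraboloid _ _ _ _).contDiffOn
    (paraboloid_self _ _ _ _) (fun z hz hzx => (h z hz).trans_lt (paraboloid_lt_paraboloid hb hzx))
    (hu.bounded.paraboloidGlue x r p b')

theorem IsViscositySuper.apply_paraboloidGlue_le (hv : IsViscositySuper I Ω f v) (hx : x ∈ Ω)
    (hr : 0 < r) (hb : b' < b) (h : ∀ z ∈ ball x r, paraboloid x (v x) p b z ≤ v z) :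
    I (paraboloidGlue v x r p b') x ≤ f x :=
  hv.test x hx _ _ isOpen_ball (mem_ball_self hr) (contDiff_paraboloid _ _ _ _).contDiffOn
    (paraboloid_self _ _ _ _) (fun z hz hzx => (paraboloid_lt_paraboloid hb hzx).trans_le (h z hz))
    (hv.bounded.paraboloidGlue x r p b')

end Paraboloid

section MaximumPoint

variable {n : ℕ} {S : Set (Rn n)} {u v : Rn n → ℝ} {x y z : Rn n} {c : ℝ}

theorem le_paraboloid_of_isMaxOn (hmax : IsMaxOn (penalizedDiff u v c) (S ×ˢ S) (x, y))
    (hy : y ∈ S) (hz : z ∈ S) : u z ≤ paraboloid x (u x) ((2 * c) • (x - y)) c z := by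
  have h : penalizedDiff u v c (z, y) ≤ penalizedDiff u v c (x, y) := hmax ⟨hz, hy⟩
  have hnorm : ‖z - y‖ ^ 2 = ‖x - y‖ ^ 2 + 2 * inner ℝ (x - y) (z - x) + ‖z - x‖ ^ 2 := by
    rw [← norm_add_sq_real, sub_add_sub_cancel']
  simp only [penalizedDiff, dist_eq_norm, hnorm] at h
  rw [paraboloid, real_inner_smul_left]
  linarith

theorem paraboloid_le_of_isMaxOn (hmax : IsMaxOn (penalizedDiff u v c) (S ×ˢ S) (x, y))
    (hx : x ∈ S) (hz : z ∈ S) : paraboloid y (v y) ((2 * c) • (x - y)) (-c) z ≤ v z := by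
  have h : penalizedDiff u v c (x, z) ≤ penalizedDiff u v c (x, y) := hmax ⟨hx, hz⟩
  have hnorm : ‖x - z‖ ^ 2 = ‖x - y‖ ^ 2 - 2 * inner ℝ (x - y) (z - y) + ‖z - y‖ ^ 2 := by
    rw [← norm_sub_sq_real, sub_sub_sub_cancel_right]
  simp only [penalizedDiff, dist_eq_norm, hnorm] at h
  rw [paraboloid, real_inner_smul_left]
  linarith

theorem sub_le_sub_of_isMaxOn (hmax : IsMaxOn (penalizedDiff u v c) (S ×ˢ S) (x, y))
    (hx : x + z ∈ S) (hy : y + z ∈ S) : u (x + z) - v (y + z) ≤ u x - v y := by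
  have h : penalizedDiff u v c (x + z, y + z) ≤ penalizedDiff u v c (x, y) := hmax ⟨hx, hy⟩
  simp only [penalizedDiff, dist_add_right] at h
  linarith

theorem doubledDiff_eq_add (u v : Rn n → ℝ) (x y z : Rn n) :
    doubledDiff u v x y z = (u (x + z) - v (y + z) - (u x - v y)) +
      (u (x + -z) - v (y + -z) - (u x - v y)) := by
  simp only [doubledDiff, secondDiff, sub_eq_add_neg x z, sub_eq_add_neg y z]
  ring

theorem doubledDiff_nonpos_of_isMaxOn {ρ : ℝ}
    (hmax : IsMaxOn (penalizedDiff u v c) (S ×ˢ S) (x, y)) (hx : ball x ρ ⊆ S) (hy : ball y ρ ⊆ S)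
    (hz : ‖z‖ < ρ) : doubledDiff u v x y z ≤ 0 := by
  have hadd : ∀ w : Rn n, ‖w‖ < ρ → u (x + w) - v (y + w) ≤ u x - v y := fun w hw =>
    sub_le_sub_of_isMaxOn hmax (hx (by simpa using hw)) (hy (by simpa using hw))
  rw [doubledDiff_eq_add]
  linarith [hadd z hz, hadd (-z) (by rwa [norm_neg])]

end MaximumPoint

section Truncation

variable {n : ℕ} {g : Rn n → ℝ} {A C r ρ : ℝ} {z : Rn n}

/-- The function equal to `A |z|²` for `|z| < r` and to `g z` for `ρ ≤ |z|`, and `0` in between. It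
is meant for `r ≤ ρ`. -/
def truncation (A r ρ : ℝ) (g : Rn n → ℝ) (z : Rn n) : ℝ :=
  (ball 0 r).indicator (fun z => A * ‖z‖ ^ 2) z + (ball 0 ρ)ᶜ.indicator g z

theorem aemeasurable_truncation (hg : AEMeasurable g) : AEMeasurable (truncation A r ρ g) :=
  (Measurable.indicator (by fun_prop) measurableSet_ball).aemeasurable.add
    (hg.indicator measurableSet_ball.compl)

theorem truncation_of_lt (hrρ : r ≤ ρ) (hz : ‖z‖ < r) : truncation A r ρ g z = A * ‖z‖ ^ 2 := by
  simp [truncation, hz, hz.trans_le hrρ]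

theorem truncation_of_le (hz : r ≤ ‖z‖) : truncation A r ρ g z = (ball 0 ρ)ᶜ.indicator g z := by
  simp [truncation, hz]

theorem tendsto_truncation {ι : Type*} {l : Filter ι} {r : ι → ℝ} (hr : Tendsto r l (𝓝 0))
    (A ρ : ℝ) (g : Rn n → ℝ) (z : Rn n) :
    Tendsto (fun j => truncation A (r j) ρ g z) l (𝓝 ((ball 0 ρ)ᶜ.indicator g z)) := by
  rcases eq_or_ne z 0 with rfl | hz
  · simpa [truncation, indicator] using tendsto_const_nhds
  · refine tendsto_const_nhds.congr' ?_
    filter_upwards [hr.eventually_le_const (norm_pos_iff.2 hz)] with j hj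
    exact (truncation_of_le hj).symm

theorem abs_truncation_le (hA : 0 ≤ A) (hC : 0 ≤ C) (hρ : 0 < ρ) (hrρ : r ≤ ρ)
    (hg : ∀ z, |g z| ≤ C) (z : Rn n) :
    |truncation A r ρ g z| ≤ (A + C / ρ ^ 2) * (1 + ρ ^ 2) * levyWeight z := by
  refine le_mul_levyWeight hρ hA hC (fun hzρ => ?_) fun hz => ?_
  · rcases lt_or_ge ‖z‖ r with hz | hz
    · rw [truncation_of_lt hrρ hz, abs_of_nonneg (by positivity)]
    · rw [truncation_of_le hz, indicator_of_notMem (by simpa using hzρ), abs_zero]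
      positivity
  · rw [truncation_of_le (hrρ.trans hz), indicator_of_mem (by simpa using hz)]
    exact hg z

end Truncation

section ViscosityInequality

variable {n : ℕ} {kmin kmax : Rn n → ℝ} {I : (Rn n → ℝ) → Rn n → ℝ} {Ω : Set (Rn n)}
  {f u v : Rn n → ℝ} {x y : Rn n} {c r ρ : ℝ}
  (hmin : IsLevyKernel kmin) (hmax : IsLevyKernel kmax)
  (hI : IsUpperElliptic (kernelsBetween kmin kmax) I) (hIt : IsTranslationInvariant I)
  (hu : IsViscositySub I Ω f u) (hv : IsViscositySuper I Ω f v)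

theorem doubledDiff_paraboloidGlue_le {p : Rn n}
    (hxy : IsMaxOn (penalizedDiff u v c) (Ω ×ˢ Ω) (x, y)) (hrρ : r ≤ ρ) (hx : ball x ρ ⊆ Ω)
    (hy : ball y ρ ⊆ Ω) (z : Rn n) :
    doubledDiff (paraboloidGlue u x r p (c + 1)) (paraboloidGlue v y r p (-(c + 1))) x y z ≤
      truncation (4 * (c + 1)) r ρ (doubledDiff u v x y) z := by
  rcases lt_or_ge ‖z‖ r with hz | hz
  · rw [doubledDiff, secondDiff_paraboloidGlue_of_lt hz, secondDiff_paraboloidGlue_of_lt hz,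
      truncation_of_lt hrρ hz]
    exact le_of_eq (by ring)
  rw [doubledDiff, secondDiff_paraboloidGlue_of_le hz, secondDiff_paraboloidGlue_of_le hz,
    ← doubledDiff, truncation_of_le hz]
  by_cases hzρ : z ∈ ball 0 ρ
  · rw [indicator_of_notMem (notMem_compl_iff.2 hzρ)]
    exact doubledDiff_nonpos_of_isMaxOn hxy hx hy (mem_ball_zero_iff.1 hzρ)
  · exact (indicator_of_mem hzρ _).ge

include hmin hmax hI hIt hu hv

theorem sub_le_integral_pucci_truncation (hc : 0 ≤ c)
    (hxy : IsMaxOn (penalizedDiff u v c) (Ω ×ˢ Ω) (x, y)) (hr : 0 < r) (hrρ : r ≤ ρ)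
    (hx : ball x ρ ⊆ Ω) (hy : ball y ρ ⊆ Ω) :
    f x - f y ≤
      ∫ z, pucci kmin kmax (truncation (4 * (c + 1)) r ρ (doubledDiff u v x y)) z := by
  have hρ := hr.trans_le hrρ
  have hxΩ := hx (mem_ball_self hρ)
  have hyΩ := hy (mem_ball_self hρ)
  let p := (2 * c) • (x - y)
  let U := paraboloidGlue u x r p (c + 1)
  let V := paraboloidGlue v y r p (-(c + 1))
  have hfx : f x ≤ I U x := hu.le_apply_paraboloidGlue hxΩ hr (lt_add_one c) fun z hz =>
    le_paraboloid_of_isMaxOn hxy hyΩ (hx (ball_subset_ball hrρ hz))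
  have hfy : I V y ≤ f y := hv.apply_paraboloidGlue_le hyΩ hr (neg_lt_neg (lt_add_one c))
    fun z hz => paraboloid_le_of_isMaxOn hxy hxΩ (hy (ball_subset_ball hrρ hz))
  have hU : IsBoundedFun U := hu.bounded.paraboloidGlue x r p (c + 1)
  have hV : IsBoundedFun V := hv.bounded.paraboloidGlue y r p (-(c + 1))
  have hUx : C11At U x := c11At_paraboloidGlue hr
  have hVy : C11At V y := c11At_paraboloidGlue hr
  obtain ⟨B, hB⟩ := exists_abs_doubledDiff_le_mul_levyWeight hU hV hUx hVy
  obtain ⟨C, hC₀, hC⟩ := exists_abs_doubledDiff_le hu.bounded hv.bounded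
  calc f x - f y ≤ I U x - I V y := sub_le_sub hfx hfy
    _ ≤ ∫ z, pucci kmin kmax (doubledDiff U V x y) z :=
        hI.sub_le_integral_pucci hIt hmin hmax hU hV hUx hVy
    _ ≤ ∫ z, pucci kmin kmax (truncation (4 * (c + 1)) r ρ (doubledDiff u v x y)) z :=
        integral_pucci_mono hmin hmax (aemeasurable_doubledDiff hU.1 hV.1 x y) hB
          (aemeasurable_truncation (aemeasurable_doubledDiff hu.bounded.1 hv.bounded.1 x y))
          (abs_truncation_le (by positivity) hC₀ hρ hrρ (hC x y))
          (ae_of_all _ (doubledDiff_paraboloidGlue_le hxy hrρ hx hy))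

theorem sub_le_integral_pucci_of_isMaxOn (hc : 0 ≤ c)
    (hxy : IsMaxOn (penalizedDiff u v c) (Ω ×ˢ Ω) (x, y)) (hρ : 0 < ρ)
    (hx : ball x ρ ⊆ Ω) (hy : ball y ρ ⊆ Ω) :
    f x - f y ≤ ∫ z, pucci kmin kmax ((ball 0 ρ)ᶜ.indicator (doubledDiff u v x y)) z := by
  obtain ⟨C, hC₀, hC⟩ := exists_abs_doubledDiff_le hu.bounded hv.bounded
  have hmeas := aemeasurable_doubledDiff hu.bounded.1 hv.bounded.1 x y
  let r : ℕ → ℝ := fun j => ρ / (j + 1)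
  have hr : ∀ j, 0 < r j := fun j => by positivity
  have hrρ : ∀ j, r j ≤ ρ := fun j =>
    div_le_self hρ.le (le_add_of_nonneg_left (Nat.cast_nonneg j))
  have hr_lim : Tendsto r atTop (𝓝 0) := by
    simpa only [r, mul_zero, mul_one_div] using
      (tendsto_one_div_add_atTop_nhds_zero_nat (𝕜 := ℝ)).const_mul ρ
  exact ge_of_tendsto' (tendsto_integral_pucci hmin hmax (fun j => aemeasurable_truncation hmeas)
    (fun j => abs_truncation_le (by positivity) hC₀ hρ (hrρ j) (hC x y))
    (ae_of_all _ (tendsto_truncation hr_lim (4 * (c + 1)) ρ _))) fun j =>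
      sub_le_integral_pucci_truncation hmin hmax hI hIt hu hv hc hxy (hr j) (hrρ j) hx hy

end ViscosityInequality

section Limit

variable {n : ℕ} {Ω : Set (Rn n)} {u v f : Rn n → ℝ} {x y : ℕ → Rn n} {q : Rn n} {c : ℕ → ℝ}
  {D m ε ρ : ℝ}

theorem exists_subseq_tendsto_translate_prod_ae (hu : IsBoundedFun u) (hv : IsBoundedFun v)
    (hx : Tendsto x atTop (𝓝 q)) (hy : Tendsto y atTop (𝓝 q)) :
    ∃ ns : ℕ → ℕ, StrictMono ns ∧ ∀ᵐ z,
      Tendsto (fun k => u (x (ns k) + z)) atTop (𝓝 (u (q + z))) ∧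
      Tendsto (fun k => v (y (ns k) + z)) atTop (𝓝 (v (q + z))) := by
  obtain ⟨hum, C, hC⟩ := hu
  obtain ⟨hvm, C', hC'⟩ := hv
  obtain ⟨ns, hns, hu_lim⟩ := exists_subseq_tendsto_translate_ae hum.aestronglyMeasurable hC hx
  obtain ⟨ms, hms, hv_lim⟩ := exists_subseq_tendsto_translate_ae hvm.aestronglyMeasurable hC'
    (hy.comp hns.tendsto_atTop)
  refine ⟨ns ∘ ms, hns.comp hms, ?_⟩
  filter_upwards [hu_lim, hv_lim] with z hzu hzv
  exact ⟨hzu.comp hms.tendsto_atTop, hzv⟩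

theorem eventually_sub_translate_le (hΩ : IsOpen Ω) (huv : ∀ p ∉ Ω, u p ≤ v p) {z : Rn n}
    (hx : Tendsto x atTop (𝓝 q)) (hy : Tendsto y atTop (𝓝 q))
    (hux : Tendsto (fun k => u (x k + z)) atTop (𝓝 (u (q + z))))
    (hvy : Tendsto (fun k => v (y k + z)) atTop (𝓝 (v (q + z))))
    (hmax : ∀ k, IsMaxOn (penalizedDiff u v (c k)) (Ω ×ˢ Ω) (x k, y k))
    (hm : 0 ≤ m) (hle : ∀ k, m ≤ u (x k) - v (y k)) (hD : Ω ⊆ ball q D) (hε : 0 < ε) :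
    ∀ᶠ k in atTop, u (x k + z) - v (y k + z) - (u (x k) - v (y k)) ≤
      (ball 0 D)ᶜ.indicator (fun _ => -m) z + ε := by
  by_cases hz : q + z ∈ Ω
  · have hzD : z ∈ ball (0 : Rn n) D := by simpa using hD hz
    rw [indicator_of_notMem (notMem_compl_iff.2 hzD), zero_add]
    filter_upwards [(hx.add_const z).eventually (hΩ.mem_nhds hz),
      (hy.add_const z).eventually (hΩ.mem_nhds hz)] with k hxk hyk
    linarith [sub_le_sub_of_isMaxOn (hmax k) hxk hyk]
  · have hind : -m ≤ (ball (0 : Rn n) D)ᶜ.indicator (fun _ => -m) z :=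
      le_indicator_apply (fun _ => le_rfl) fun _ => neg_nonpos.2 hm
    filter_upwards [(hux.sub hvy).eventually_lt_const (u := ε) (by linarith [huv _ hz])] with k hk
    linarith [hle k]

theorem eventually_indicator_doubledDiff_le (hΩ : IsOpen Ω) (huv : ∀ p ∉ Ω, u p ≤ v p) {z : Rn n}
    (hx : Tendsto x atTop (𝓝 q)) (hy : Tendsto y atTop (𝓝 q))
    (hlim : ∀ w ∈ ({z, -z} : Set (Rn n)), Tendsto (fun k => u (x k + w)) atTop (𝓝 (u (q + w))) ∧
      Tendsto (fun k => v (y k + w)) atTop (𝓝 (v (q + w))))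
    (hmax : ∀ k, IsMaxOn (penalizedDiff u v (c k)) (Ω ×ˢ Ω) (x k, y k))
    (hm : 0 ≤ m) (hle : ∀ k, m ≤ u (x k) - v (y k)) (hD : Ω ⊆ ball q D) (hρD : ρ ≤ D)
    (hε : 0 < ε) :
    ∀ᶠ k in atTop, (ball 0 ρ)ᶜ.indicator (doubledDiff u v (x k) (y k)) z ≤
      (ball 0 D)ᶜ.indicator (fun _ => -(2 * m)) z + ε := by
  by_cases hz : z ∈ ball (0 : Rn n) ρ
  · have hzD := ball_subset_ball hρD hz
    simp only [indicator_of_notMem (notMem_compl_iff.2 hz),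
      indicator_of_notMem (notMem_compl_iff.2 hzD), zero_add]
    exact Eventually.of_forall fun _ => hε.le
  have hw : ∀ w ∈ ({z, -z} : Set (Rn n)), ∀ᶠ k in atTop,
      u (x k + w) - v (y k + w) - (u (x k) - v (y k)) ≤
        (ball 0 D)ᶜ.indicator (fun _ => -m) w + ε / 2 := fun w hw =>
    eventually_sub_translate_le hΩ huv hx hy (hlim w hw).1 (hlim w hw).2 hmax hm hle hD
      (half_pos hε)
  filter_upwards [hw z (by simp), hw (-z) (by simp)] with k hpos hneg
  have hind : (ball 0 D)ᶜ.indicator (fun _ => -(2 * m)) z =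
      (ball 0 D)ᶜ.indicator (fun _ => -m) z + (ball 0 D)ᶜ.indicator (fun _ => -m) (-z) := by
    by_cases hzD : ‖z‖ < D <;> simp [indicator, hzD, two_mul]
  rw [indicator_of_mem hz, doubledDiff_eq_add, hind]
  linarith

theorem integral_pucci_indicator_neg {kmin kmax : Rn n → ℝ} {S : Set (Rn n)} {t : ℝ}
    (hS : MeasurableSet S) (ht : 0 ≤ t) :
    ∫ z, pucci kmin kmax (S.indicator fun _ => -t) z = -(t * ∫ z in S, kmin z) := by
  have hpucci : pucci kmin kmax (S.indicator fun _ => -t) = S.indicator fun z => -t * kmin z := by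
    funext z
    by_cases hz : z ∈ S <;> simp [pucci, hz, ht, mul_comm]
  rw [hpucci, integral_indicator hS, integral_const_mul, neg_mul]

section Viscosity

variable {kmin kmax : Rn n → ℝ} {I : (Rn n → ℝ) → Rn n → ℝ}

theorem mul_integral_tail_nonpos (hmin : IsLevyKernel kmin) (hmax : IsLevyKernel kmax)
    (hI : IsUpperElliptic (kernelsBetween kmin kmax) I) (hIt : IsTranslationInvariant I)
    (hu : IsViscositySub I Ω f u) (hv : IsViscositySuper I Ω f v)
    (hΩ : IsOpen Ω) (huv : ∀ p ∉ Ω, u p ≤ v p) (hf : ContinuousAt f q)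
    (hx : Tendsto x atTop (𝓝 q)) (hy : Tendsto y atTop (𝓝 q)) (hc : ∀ k, 0 ≤ c k)
    (hxy : ∀ k, IsMaxOn (penalizedDiff u v (c k)) (Ω ×ˢ Ω) (x k, y k))
    (hm : 0 ≤ m) (hle : ∀ k, m ≤ u (x k) - v (y k)) (hρ : 0 < ρ) (hball : ball q (2 * ρ) ⊆ Ω)
    (hρD : ρ ≤ D) (hD : Ω ⊆ ball q D) : 2 * m * ∫ z in (ball 0 D)ᶜ, kmin z ≤ 0 := by
  obtain ⟨C, hC₀, hC⟩ := exists_abs_doubledDiff_le hu.bounded hv.bounded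
  obtain ⟨ns, hns, hlim⟩ := exists_subseq_tendsto_translate_prod_ae hu.bounded hv.bounded hx hy
  have hlim_neg := (Measure.measurePreserving_neg
    (volume : Measure (Rn n))).quasiMeasurePreserving.ae hlim
  have hxns := hx.comp hns.tendsto_atTop
  have hyns := hy.comp hns.tendsto_atTop
  have hsub : ∀ w, dist w q < ρ → ball w ρ ⊆ Ω := fun w hw =>
    (ball_subset_ball' (by linarith)).trans hball
  have hM : 0 ≤ max C (2 * m) := hC₀.trans (le_max_left _ _)
  have hlimit : 0 ≤ ∫ z, pucci kmin kmax ((ball 0 D)ᶜ.indicator fun _ => -(2 * m)) z := by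
    refine le_integral_pucci_of_eventually_le hmin hmax
      (d := fun k => (ball 0 ρ)ᶜ.indicator (doubledDiff u v (x (ns k)) (y (ns k))))
      (A := fun k => f (x (ns k)) - f (y (ns k)))
      (fun k => (aemeasurable_doubledDiff hu.bounded.1 hv.bounded.1 _ _).indicator
        measurableSet_ball.compl)
      (fun k => abs_indicator_le_mul_levyWeight hM hρ le_rfl fun z =>
        (hC _ _ z).trans (le_max_left _ _))
      (aemeasurable_const.indicator measurableSet_ball.compl)
      (abs_indicator_le_mul_levyWeight hM hρ (compl_subset_compl.2 (ball_subset_ball hρD))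
        fun _ => ?_) ?_ ?_ ?_
    · rw [abs_neg, abs_of_nonneg (by positivity)]
      exact le_max_right _ _
    · filter_upwards [hlim, hlim_neg] with z hz hz_neg ε hε
      refine eventually_indicator_doubledDiff_le hΩ huv hxns hyns ?_ (fun k => hxy (ns k)) hm
        (fun k => hle (ns k)) hD hρD hε
      rintro w (rfl | rfl)
      exacts [hz, hz_neg]
    · filter_upwards [hxns.eventually (ball_mem_nhds q hρ),
        hyns.eventually (ball_mem_nhds q hρ)] with k hxk hyk
      exact sub_le_integral_pucci_of_isMaxOn hmin hmax hI hIt hu hv (hc _) (hxy _) hρ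
        (hsub _ hxk) (hsub _ hyk)
    · simpa using (hf.tendsto.comp hxns).sub (hf.tendsto.comp hyns)
  rw [integral_pucci_indicator_neg measurableSet_ball.compl (by positivity)] at hlimit
  exact neg_nonneg.1 hlimit

end Viscosity

end Limit

section WeakScaling

variable {φ : ℝ → ℝ} {a σ₁ σ₂ r : ℝ} (hφ : WeakScaling φ a σ₁ σ₂)

include hφ

theorem WeakScaling.one_div_le_of_le_one (hr : 0 < r) (hr₁ : r ≤ 1) :
    1 / φ r ≤ a / φ 1 * r ^ (-σ₂) := by
  have hφr := hφ.pos r hr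
  have hφ₁ := hφ.pos 1 one_pos
  have h := (hφ.scaling r 1 hr hr₁).2
  rw [one_div, Real.inv_rpow hr.le, ← Real.rpow_neg hr.le, div_le_iff₀ hφr] at h
  rw [div_le_iff₀ hφr, div_mul_eq_mul_div, div_mul_eq_mul_div, le_div_iff₀ hφ₁, one_mul]
  exact h

theorem WeakScaling.one_div_le_of_one_le (hr : 1 ≤ r) : 1 / φ r ≤ a / φ 1 * r ^ (-σ₁) := by
  have hr₀ := one_pos.trans_le hr
  have ha := one_pos.trans_le hφ.one_le_a
  have hφ₁ := hφ.pos 1 one_pos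
  have h := (hφ.scaling 1 r one_pos hr).1
  have hrσ : 0 < r ^ σ₁ := Real.rpow_pos_of_pos hr₀ _
  rw [div_one, le_div_iff₀ hφ₁] at h
  calc 1 / φ r ≤ 1 / (a⁻¹ * r ^ σ₁ * φ 1) := one_div_le_one_div_of_le (by positivity) h
    _ = a / φ 1 * r ^ (-σ₁) := by
        rw [Real.rpow_neg hr₀.le]
        field_simp

theorem WeakScaling.div_le_rpow_of_le_one (hr : 0 < r) (hr₁ : r ≤ 1) :
    r / (1 + r ^ 2) / φ r ≤ a / φ 1 * r ^ (1 - σ₂) := by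
  have hφr := hφ.pos r hr
  calc r / (1 + r ^ 2) / φ r ≤ r / φ r := by
        gcongr
        exact div_le_self hr.le (le_add_of_nonneg_right (sq_nonneg r))
    _ = r * (1 / φ r) := by ring
    _ ≤ r * (a / φ 1 * r ^ (-σ₂)) := by
        gcongr
        exact hφ.one_div_le_of_le_one hr hr₁
    _ = a / φ 1 * r ^ (1 - σ₂) := by
        rw [sub_eq_add_neg, Real.rpow_add hr, Real.rpow_one]
        ring

theorem WeakScaling.div_le_rpow_of_one_le (hr : 1 ≤ r) :
    r / (1 + r ^ 2) / φ r ≤ a / φ 1 * r ^ (-1 - σ₁) := by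
  have hr₀ := one_pos.trans_le hr
  have hφr := hφ.pos r hr₀
  calc r / (1 + r ^ 2) / φ r ≤ r⁻¹ / φ r := by
        gcongr
        rw [div_le_iff₀ (by positivity), mul_add, sq, inv_mul_cancel_left₀ hr₀.ne']
        exact le_add_of_nonneg_left (by positivity)
    _ = r⁻¹ * (1 / φ r) := by ring
    _ ≤ r⁻¹ * (a / φ 1 * r ^ (-σ₁)) := by
        gcongr
        exact hφ.one_div_le_of_one_le hr
    _ = a / φ 1 * r ^ (-1 - σ₁) := by
        rw [sub_eq_add_neg, Real.rpow_add hr₀, Real.rpow_neg_one]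
        ring

theorem WeakScaling.integrableOn_Ioi_div :
    IntegrableOn (fun r => r / (1 + r ^ 2) / φ r) (Ioi 0) := by
  have hmeas : AEMeasurable (fun r : ℝ => r / (1 + r ^ 2) / φ r) (volume.restrict (Ioi 0)) :=
    (by fun_prop : Measurable fun r : ℝ => r / (1 + r ^ 2)).aemeasurable.div hφ.meas
  have hnorm : ∀ r > 0, ‖r / (1 + r ^ 2) / φ r‖ = r / (1 + r ^ 2) / φ r := fun r hr =>
    Real.norm_of_nonneg (div_nonneg (by positivity) (hφ.pos r hr).le)
  rw [← Ioc_union_Ioi_eq_Ioi zero_le_one]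
  refine IntegrableOn.union ?_ ?_
  · have hpow : IntegrableOn (fun r : ℝ => a / φ 1 * r ^ (1 - σ₂)) (Ioc 0 1) :=
      ((intervalIntegrable_iff_integrableOn_Ioc_of_le zero_le_one).1
        (intervalIntegral.intervalIntegrable_rpow' (by linarith [hφ.σ₂_lt_two]))).const_mul _
    refine hpow.mono' (hmeas.mono_set Ioc_subset_Ioi_self).aestronglyMeasurable ?_
    filter_upwards [ae_restrict_mem measurableSet_Ioc] with r hr
    exact (hnorm r hr.1).trans_le (hφ.div_le_rpow_of_le_one hr.1 hr.2)
  · have hpow : IntegrableOn (fun r : ℝ => a / φ 1 * r ^ (-1 - σ₁)) (Ioi 1) :=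
      (integrableOn_Ioi_rpow_of_lt (by linarith [hφ.σ₁_pos]) one_pos).const_mul _
    refine hpow.mono' (hmeas.mono_set (Ioi_subset_Ioi zero_le_one)).aestronglyMeasurable ?_
    filter_upwards [ae_restrict_mem measurableSet_Ioi] with r hr
    exact (hnorm r (one_pos.trans hr)).trans_le (hφ.div_le_rpow_of_one_le (mem_Ioi.1 hr).le)

end WeakScaling

section ScalingKernel

variable {n : ℕ} {φ : ℝ → ℝ} {a σ₁ σ₂ lam Lam t : ℝ}

/-- The kernel `|y|⁻ⁿ φ(|y|)⁻¹` to which the kernels of the class `𝓛₀` are comparable. -/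
def refKernel (φ : ℝ → ℝ) (y : Rn n) : ℝ :=
  1 / (‖y‖ ^ n * φ ‖y‖)

theorem WeakScaling.refKernel_pos (hφ : WeakScaling φ a σ₁ σ₂) {y : Rn n} (hy : y ≠ 0) :
    0 < refKernel φ y := by
  have h := norm_pos_iff.2 hy
  exact one_div_pos.2 (mul_pos (pow_pos h n) (hφ.pos _ h))

theorem exists_abs_one_sub_cos_le_mul_levyWeight (i : Fin n) :
    ∃ B, ∀ y : Rn n, |1 - Real.cos (y i)| ≤ B * levyWeight y := by
  refine ⟨_, fun y => le_mul_levyWeight one_pos (A := 1 / 2) (C := 2) (by norm_num) zero_le_two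
    (fun _ => ?_) fun _ => ?_⟩ <;> rw [abs_of_nonneg (sub_nonneg.2 (Real.cos_le_one _))]
  · have hy : y i ^ 2 ≤ ‖y‖ ^ 2 := sq_le_sq.2 (by simpa using PiLp.norm_apply_le y i)
    linarith [Real.one_sub_sq_div_two_le_cos (x := y i)]
  · linarith [Real.neg_one_le_cos (y i)]

variable [NeZero n]

theorem WeakScaling.isLevyKernel_refKernel (hφ : WeakScaling φ a σ₁ σ₂) :
    IsLevyKernel (refKernel φ : Rn n → ℝ) := by
  refine ⟨(volume.ae_ne 0).mono fun y hy => (hφ.refKernel_pos hy).le,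
    (integrable_fun_norm_addHaar volume
      (f := fun r : ℝ => r ^ 2 / (1 + r ^ 2) * (1 / (r ^ n * φ r)))).2 ?_⟩
  refine hφ.integrableOn_Ioi_div.congr_fun (fun r hr => ?_) measurableSet_Ioi
  have hr₀ : 0 < r := hr
  have hφr := hφ.pos r hr
  have hpow : r ^ n = r ^ (n - 1) * r := (pow_sub_one_mul (NeZero.ne n) r).symm
  simp only [finrank_euclideanSpace, Fintype.card_fin, smul_eq_mul, hpow]
  field_simp

theorem WeakScaling.normConst_pos (hφ : WeakScaling φ a σ₁ σ₂) : 0 < normConst n φ := by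
  obtain ⟨B, hB⟩ := exists_abs_one_sub_cos_le_mul_levyWeight (0 : Fin n)
  have hint : Integrable fun y : Rn n => (1 - Real.cos (y 0)) * refKernel φ y :=
    hφ.isLevyKernel_refKernel.integrable_mul (by fun_prop) hB
  have hnn : 0 ≤ᵐ[volume] fun y : Rn n => (1 - Real.cos (y 0)) * refKernel φ y :=
    hφ.isLevyKernel_refKernel.nonneg.mono fun y hy =>
      mul_nonneg (sub_nonneg.2 (Real.cos_le_one _)) hy
  have hform : normConst n φ = (∫ y : Rn n, (1 - Real.cos (y 0)) * refKernel φ y)⁻¹ := by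
    simp only [normConst, refKernel, mul_one_div]
  rw [hform]
  refine inv_pos.2 ((integral_pos_iff_support_of_nonneg_ae hnn hint).2 ?_)
  have hopen : IsOpen {y : Rn n | Real.cos (y 0) < 1} := isOpen_lt (by fun_prop) continuous_const
  refine (hopen.measure_pos volume ⟨EuclideanSpace.single 0 Real.pi, by simp⟩).trans_le
    (measure_mono fun y (hy : Real.cos (y 0) < 1) => ?_)
  have hy₀ : y ≠ 0 := by
    rintro rfl
    simp at hy
  exact (mul_pos (sub_pos.2 hy) (hφ.refKernel_pos hy₀)).ne'

/-- The bounds `C_φ t |y|⁻ⁿ φ(|y|)⁻¹`, for `t = λ` and `t = Λ`, of the kernels of `𝓛₀`. -/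
def boundKernel (n : ℕ) [NeZero n] (φ : ℝ → ℝ) (t : ℝ) (y : Rn n) : ℝ :=
  normConst n φ * t * refKernel φ y

theorem WeakScaling.boundKernel_pos (hφ : WeakScaling φ a σ₁ σ₂) (ht : 0 < t) {y : Rn n}
    (hy : y ≠ 0) : 0 < boundKernel n φ t y :=
  mul_pos (mul_pos hφ.normConst_pos ht) (hφ.refKernel_pos hy)

theorem WeakScaling.isLevyKernel_boundKernel (hφ : WeakScaling φ a σ₁ σ₂) (ht : 0 ≤ t) :
    IsLevyKernel (boundKernel n φ t) :=
  hφ.isLevyKernel_refKernel.const_mul (mul_nonneg hφ.normConst_pos.le ht)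

theorem WeakScaling.classL0_subset_kernelsBetween (hφ : WeakScaling φ a σ₁ σ₂) (hlam : 0 ≤ lam) :
    classL0 n φ lam Lam ⊆ kernelsBetween (boundKernel n φ lam) (boundKernel n φ Lam) := by
  rintro K ⟨-, -, hint, hbound⟩
  have hform : ∀ t y, normConst n φ * (t / (‖y‖ ^ n * φ ‖y‖)) = boundKernel n φ t y :=
    fun t y => by rw [boundKernel, refKernel, mul_assoc, mul_one_div]
  simp only [hform] at hbound
  have hlower : boundKernel n φ lam ≤ᵐ[volume] K :=
    (volume.ae_ne 0).mono fun y hy => (hbound y hy).1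
  have hupper : K ≤ᵐ[volume] boundKernel n φ Lam :=
    (volume.ae_ne 0).mono fun y hy => (hbound y hy).2
  exact ⟨⟨(hφ.isLevyKernel_boundKernel hlam).nonneg.trans hlower, hint⟩, hlower, hupper⟩

end ScalingKernel

end IntegroDiff

end

open IntegroDiff MeasureTheory Metric in
theorem mainTheorem8_general {n : ℕ} {kmin kmax : Rn n → ℝ} (hmin : IsLevyKernel kmin)
    (hmax : IsLevyKernel kmax) (hpos : ∀ D > 0, 0 < ∫ z in (ball 0 D)ᶜ, kmin z)
    {I : (Rn n → ℝ) → Rn n → ℝ} (hI : IsUpperElliptic (kernelsBetween kmin kmax) I)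
    (hIt : IsTranslationInvariant I) {Ω : Set (Rn n)} (hΩ : IsOpen Ω)
    (hΩb : Bornology.IsBounded Ω) {f : Rn n → ℝ} (hf : ContinuousOn f Ω) {u v : Rn n → ℝ}
    (hu : IsViscositySub I Ω f u) (hv : IsViscositySuper I Ω f v) (huv : ∀ x ∉ Ω, u x ≤ v x) :
    ∀ x ∈ Ω, u x ≤ v x := by
  intro p hp
  by_contra! hlt
  have hpΩ := subset_closure hp
  obtain ⟨c, x, y, q, hc, hmaxOn, hx, hy, hq⟩ :=
    exists_tendsto_isMaxOn_penalizedDiff hΩb.isCompact_closure hu.usc hv.lsc hpΩ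
  have hqΩ : q ∈ Ω := by
    by_contra hqΩ
    linarith [huv q hqΩ]
  obtain ⟨δ, hδ, hball⟩ := Metric.isOpen_iff.1 hΩ q hqΩ
  obtain ⟨D, hD, hΩD⟩ := hΩb.subset_ball_lt (δ / 2) q
  have htail := mul_integral_tail_nonpos hmin hmax hI hIt hu hv hΩ huv
    (hf.continuousAt (hΩ.mem_nhds hqΩ)) hx hy hc
    (fun k => (hmaxOn k).on_subset (Set.prod_mono subset_closure subset_closure))
    (sub_pos.2 hlt).le (fun k => sub_le_of_isMaxOn_penalizedDiff (hc k) hpΩ (hmaxOn k))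
    (half_pos hδ) (by rwa [mul_div_cancel₀ δ two_ne_zero]) hD.le hΩD
  exact htail.not_gt (mul_pos (mul_pos two_pos (sub_pos.2 hlt)) (hpos D ((half_pos hδ).trans hD)))

theorem mainTheorem8 (n : ℕ) [NeZero n] (φ : ℝ → ℝ) (a σ₁ σ₂ lam Lam : ℝ)
    (hφ : IntegroDiff.WeakScaling φ a σ₁ σ₂) (hlam : 0 < lam) (hLam : lam ≤ Lam)
    (I : (IntegroDiff.Rn n → ℝ) → IntegroDiff.Rn n → ℝ)
    (hI : IntegroDiff.IsElliptic (IntegroDiff.classL0 n φ lam Lam) I)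
    (hIt : IntegroDiff.IsTranslationInvariant I)
    (Ω : Set (IntegroDiff.Rn n)) (hΩ : IsOpen Ω) (hΩb : Bornology.IsBounded Ω)
    (f : IntegroDiff.Rn n → ℝ) (hf : ContinuousOn f Ω)
    (u v : IntegroDiff.Rn n → ℝ)
    (hu : IntegroDiff.IsViscositySub I Ω f u)
    (hv : IntegroDiff.IsViscositySuper I Ω f v)
    (huv : ∀ x, x ∉ Ω → u x ≤ v x) :
    ∀ x ∈ Ω, u x ≤ v x := by
  have hmin := hφ.isLevyKernel_boundKernel (n := n) hlam.le
  exact mainTheorem8_general hmin (hφ.isLevyKernel_boundKernel (hlam.le.trans hLam))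
    (fun D => hmin.setIntegral_compl_ball_pos fun y => hφ.boundKernel_pos hlam)
    (hI.isUpperElliptic.mono (hφ.classL0_subset_kernelsBetween hlam.le)) hIt hΩ hΩb hf hu hv huv
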